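/- Let $n\ge 1$, let $X=\begin{pmatrix}x_1&\cdots&x_n\\ y_1&\cdots&y_n\end{pmatrix}$ be a $2\times n$ matrix of variables, and let $\mathcal R_n=\mathbb C[X]^{SL_2}$ be the ring of polynomials $f$ with $f(gX)=f(X)$ for all $g\in SL_2(\mathbb C)$. Grade $\mathcal R_n$ by giving $2\times 2$ minors degree $1$: its degree-$d$ component $\mathcal R_n^{(d)}$ consists of the invariants that are homogeneous of degree $2d$ in the entries of $X$ (then $\mathcal R_n=\bigoplus_{d\ge0}\mathcal R_n^{(d)}$). For $1\le i,j\le n$ put $X_{(i,j)}=x_iy_j-x_jy_i$. Let $\mathbb P_{k,m}$ be the set of parallelogram polyominoes of width $k$ and height $m$: pairs $\pi=(\alpha,\beta)$ of north-east lattice paths from $(0,0)$ to $(k,m)$ such that, on every vertical line, all points of $\beta$ are strictly below all points of $\alpha$, apart from the two common endpoints. The height sequence of such a path lists the heights of its $k$ east steps, from left to right. For $\pi=(\alpha,\beta)\in\mathbb P_{d+1,n-1}$ with height sequences $\alpha=a_1a_2\cdots a_{d+1}$ and $\beta=b_0b_1\cdots b_d$, let $$X_\pi=\prod_{i=1}^d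 X_{(b_i+1,\,a_i+1)}.$$ Proposition. For every $d\ge 0$, the family $(X_\pi)_{\pi\in\mathbb P_{d+1,n-1}}$ is a linear basis of $\mathcal R_n^{(d)}$ over $\mathbb C$. Consequently, the Hilbert series of $\mathcal R_n$ is $$\mathcal R_n(x):=\sum_{d\ge0}\dim_{\mathbb C}\bigl(\mathcal R_n^{(d)}\bigr)\,x^d=\sum_{d\ge0}|\mathbb P_{d+1,n-1}|\,x^d,$$ and, for $n\ge3$, $$\mathcal R_n(x)=\frac{1}{(1-x)^{2n-3}}\sum_{k=0}^{n-3}\frac1{k+1}\binom{n-3}{k}\binom{n-2}{k}x^k .$$ -/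

import Mathlib

open MvPolynomial

/-- A north-east lattice path from `(0,0)` to `(k,n)`: the sequence of its `k + n + 1` points in
`ℕ × ℕ`, each step being an east step `(1,0)` or a north step `(0,1)`. -/
@[ext]
structure NEPath (k n : ℕ) where
  point : Fin (k + n + 1) → ℕ × ℕ
  start : point 0 = (0, 0)
  finish : point (Fin.last (k + n)) = (k, n)
  step : ∀ i : Fin (k + n),
    point i.succ = point i.castSucc + (1, 0) ∨ point i.succ = point i.castSucc + (0, 1)

namespace NEPath

variable {k n : ℕ}

theorem monotone_point (α : NEPath k n) : Monotone α.point := by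
  rw [Fin.monotone_iff_le_succ]
  intro i
  rcases α.step i with h | h <;> rw [h] <;> simp

theorem point_le (α : NEPath k n) (i : Fin (k + n + 1)) : α.point i ≤ (k, n) := by
  rw [← α.finish]
  exact α.monotone_point (Fin.le_last i)

/-- For each `i < k` there is exactly one height at which the path makes its east step from the
vertical line `x = i` to the vertical line `x = i + 1`. -/
theorem existsUnique_height (α : NEPath k n) (i : Fin k) :
    ∃! h : Fin (n + 1), ∃ j : Fin (k + n),
      α.point j.castSucc = ((i : ℕ), (h : ℕ)) ∧ α.point j.succ = ((i : ℕ) + 1, (h : ℕ)) := by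
  have key : ∃ j : Fin (k + n), (α.point j.castSucc).1 ≤ i ∧ (i : ℕ) < (α.point j.succ).1 := by
    by_contra! hcon
    have : ∀ j : Fin (k + n + 1), (α.point j).1 ≤ i := by
      intro j
      induction j using Fin.induction with
      | zero => simp [α.start]
      | succ j ih => exact hcon j ih
    have h := this (Fin.last _)
    rw [α.finish] at h
    have := i.2
    simp only at h
    omega
  obtain ⟨j, hj1, hj2⟩ := key
  have hb := (α.point_le j.castSucc).2
  refine ⟨⟨(α.point j.castSucc).2, by simp only at hb; omega⟩, ⟨j, ?_⟩, ?_⟩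
  · rcases α.step j with h | h
    · rw [h] at hj2 ⊢
      simp only [Prod.fst_add] at hj2
      refine ⟨Prod.ext ?_ rfl, Prod.ext ?_ ?_⟩ <;> simp <;> omega
    · rw [h] at hj2
      simp only [Prod.fst_add] at hj2
      omega
  · rintro h' ⟨j', h1, h2⟩
    have hjj : j' = j := by
      rcases lt_trichotomy j' j with hlt | heq | hgt
      · have hm : (α.point j'.succ).1 ≤ (α.point j.castSucc).1 :=
          (α.monotone_point (Fin.succ_le_castSucc_iff.2 hlt)).1
        rw [h2] at hm
        simp only at hm
        omega
      · exact heq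
      · have hm : (α.point j.succ).1 ≤ (α.point j'.castSucc).1 :=
          (α.monotone_point (Fin.succ_le_castSucc_iff.2 hgt)).1
        rw [h1] at hm
        simp only at hm
        omega
    subst hjj
    apply Fin.ext
    simp [h1]

/-- The height sequence of a path: `α.height i` is the height of the east step from `x = i` to
`x = i + 1`. So the sequence is `α.height 0, …, α.height (k - 1)`. -/
noncomputable def height (α : NEPath k n) (i : Fin k) : Fin (n + 1) :=
  (α.existsUnique_height i).choose

instance : Finite (NEPath k n) := by
  let f : NEPath k n → (Fin (k + n + 1) → Set.Iic ((k, n) : ℕ × ℕ)) :=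
    fun α i => ⟨α.point i, α.point_le i⟩
  have : Finite (Set.Iic ((k, n) : ℕ × ℕ)) := (Set.finite_Iic _).to_subtype
  refine Finite.of_injective f fun α β h => NEPath.ext (funext fun i => ?_)
  exact congrArg Subtype.val (congrFun h i)

end NEPath

/-- A parallelogram polyomino of width `k` and height `n`: a pair of north-east paths from `(0,0)`
to `(k,n)` such that, on every vertical line, the points of `lower` are strictly below those of
`upper`, apart from the two common endpoints. -/
@[ext]
structure ParallelogramPolyomino (k n : ℕ) where
  upper : NEPath k n
  lower : NEPath k n
  strictly_below : ∀ i j : Fin (k + n + 1),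
    (lower.point i).1 = (upper.point j).1 →
    ¬ (i = 0 ∧ j = 0) → ¬ (i = Fin.last (k + n) ∧ j = Fin.last (k + n)) →
    (lower.point i).2 < (upper.point j).2

instance (k n : ℕ) : Finite (ParallelogramPolyomino k n) :=
  Finite.of_injective (fun π => (π.upper, π.lower)) fun _ _ h =>
    ParallelogramPolyomino.ext (congrArg Prod.fst h) (congrArg Prod.snd h)

/-- The `2 × 2` minor of the generic `2 × n` matrix `X` on the columns `i`, `j` (in this order);
columns are numbered from `0`. -/
noncomputable def columnMinor {n : ℕ} (i j : Fin n) : MvPolynomial (Fin 2 × Fin n) ℂ :=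
  ((Matrix.mvPolynomialX (Fin 2) (Fin n) ℂ).submatrix id ![i, j]).det

/-- The minor monomial of a polyomino of width `d + 1` and height `m`, for a generic matrix with
`m + 1` columns. If the height sequences of the upper and of the lower path are `a₁ … a_{d+1}` and
`b₀ … b_d`, it is the product over `1 ≤ i ≤ d` of the minors on the columns `b_i` and `a_i`
(numbered from `0`, hence the columns `b_i + 1` and `a_i + 1` when numbered from `1`). -/
noncomputable def ParallelogramPolyomino.minorMonomial {d m : ℕ}
    (π : ParallelogramPolyomino (d + 1) m) : MvPolynomial (Fin 2 × Fin (m + 1)) ℂ :=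
  ∏ i : Fin d, columnMinor (π.lower.height i.succ) (π.upper.height i.castSucc)

/-- The substitution `f(X) ↦ f(gX)` on polynomials in the entries of the generic `2 × n`
matrix `X`. -/
noncomputable def leftSubst (n : ℕ) (g : Matrix.SpecialLinearGroup (Fin 2) ℂ) :
    MvPolynomial (Fin 2 × Fin n) ℂ →ₐ[ℂ] MvPolynomial (Fin 2 × Fin n) ℂ :=
  aeval fun p : Fin 2 × Fin n =>
    ((g : Matrix (Fin 2) (Fin 2) ℂ).map (C : ℂ → MvPolynomial (Fin 2 × Fin n) ℂ) *
      Matrix.mvPolynomialX (Fin 2) (Fin n) ℂ : Matrix (Fin 2) (Fin n) _) p.1 p.2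

/-- The ring `ℂ[X]^{SL₂}` of invariants, `X` being a `2 × n` matrix of variables. -/
noncomputable def invariantRing (n : ℕ) : Subalgebra ℂ (MvPolynomial (Fin 2 × Fin n) ℂ) where
  carrier := {f | ∀ g : Matrix.SpecialLinearGroup (Fin 2) ℂ, leftSubst n g f = f}
  mul_mem' hf hg s := by rw [map_mul, hf s, hg s]
  add_mem' hf hg s := by rw [map_add, hf s, hg s]
  algebraMap_mem' c s := AlgHom.commutes _ c

/-- The degree `d` component of the ring of invariants, where `2 × 2` minors have degree `1`:
the invariants that are homogeneous of degree `2 * d` in the entries of `X`. -/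
noncomputable def invariantComponent (n d : ℕ) : Submodule ℂ (MvPolynomial (Fin 2 × Fin n) ℂ) :=
  Subalgebra.toSubmodule (invariantRing n) ⊓ homogeneousSubmodule (Fin 2 × Fin n) ℂ (2 * d)

/-- The Hilbert series of the ring of invariants (minors having degree `1`). -/
noncomputable def invariantHilbertSeries (n : ℕ) : PowerSeries ℚ :=
  PowerSeries.mk fun d => (Module.finrank ℂ (invariantComponent n d) : ℚ)

/-! Put `n = m + 1` and let `h_k` be the number of multisets of size `k` of columns. The last upper
height is forced to be `m` and the first lower height to be `0`. Without these two entries,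
polyominoes of width `d + 1` are exactly the pairs of weakly increasing sequences of length `d` with
`b_i < a_i`, that is, two-row semistandard tableaux.

The basis statement needs no straightening law. For `d ≥ 1` put `N = h_d² - h_{d+1} h_{d-1}`; three
bounds close up. (1) There are at least `N` tableaux: exchanging tails at the first violation of
`b_i < a_i` injects the other pairs into pairs of sequences of lengths `d + 1` and `d - 1`
(`card_mul_card_le_card_standardPair_add`). (2) The products `X_π` are independent invariants, since
their leading monomials are distinct (`linearIndependent_minorMonomial`). (3) The invariants have
dimension at most `N`: they have degree `d` in each row and are killed by `E = ∑ x_j ∂/∂y_j`, which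
by `sl₂` theory maps bidegree `(d, d)` onto `(d + 1, d - 1)` (`finrank_le_of_polarization_eq_zero`).
So `N ≤ #polyominoes ≤ dim ≤ N`, with equality throughout; for `d = 0` both numbers are `1`.

The formula for `N` makes the Hilbert series the hypergeometric series `₂F₁(m + 1, m; 2; x)`.
Euler's transformation gives `(1 - x)^(2m - 1)` times it as `₂F₁(1 - m, 2 - m; 2; x)`, which for `m
≥ 2` is the polynomial with Narayana coefficients. -/

/-! ### Lattice paths and their height sequences -/

namespace NEPath

variable {k n : ℕ}

theorem exists_eastStep (α : NEPath k n) (i : Fin k) : ∃ j : Fin (k + n),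
    α.point j.castSucc = ((i : ℕ), (α.height i : ℕ)) ∧
      α.point j.succ = ((i : ℕ) + 1, (α.height i : ℕ)) :=
  (α.existsUnique_height i).choose_spec.1

theorem height_eq_of_eastStep (α : NEPath k n) {i : Fin k} {h : Fin (n + 1)} {j : Fin (k + n)}
    (h₁ : α.point j.castSucc = ((i : ℕ), (h : ℕ)))
    (h₂ : α.point j.succ = ((i : ℕ) + 1, (h : ℕ))) : α.height i = h :=
  (α.existsUnique_height i).unique (α.existsUnique_height i).choose_spec.1 ⟨j, h₁, h₂⟩

theorem point_fst_add_snd (α : NEPath k n) (j : Fin (k + n + 1)) :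
    (α.point j).1 + (α.point j).2 = j := by
  induction j using Fin.induction with
  | zero => simp [α.start]
  | succ j ih =>
    rcases α.step j with h | h <;> rw [h] <;> simp at ih ⊢ <;> omega

theorem height_le_of_lt_fst (α : NEPath k n) (i : Fin k) {j : Fin (k + n + 1)}
    (h : (i : ℕ) < (α.point j).1) : (α.height i : ℕ) ≤ (α.point j).2 := by
  obtain ⟨l, h₁, h₂⟩ := α.exists_eastStep i
  rcases le_or_gt j l.castSucc with hj | hj
  · have := (α.monotone_point hj).1
    rw [h₁] at this
    simp only at this
    omega
  · have := (α.monotone_point (Fin.castSucc_lt_iff_succ_le.1 hj)).2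
    rwa [h₂] at this

theorem le_height_of_fst_le (α : NEPath k n) (i : Fin k) {j : Fin (k + n + 1)}
    (h : (α.point j).1 ≤ i) : (α.point j).2 ≤ α.height i := by
  obtain ⟨l, h₁, h₂⟩ := α.exists_eastStep i
  rcases le_or_gt j l.castSucc with hj | hj
  · have := (α.monotone_point hj).2
    rwa [h₁] at this
  · have := (α.monotone_point (Fin.castSucc_lt_iff_succ_le.1 hj)).1
    rw [h₂] at this
    simp only at this
    omega

theorem monotone_height (α : NEPath k n) : Monotone α.height := by
  intro i j hij
  obtain ⟨l, h₁, -⟩ := α.exists_eastStep i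
  have := α.le_height_of_fst_le j (j := l.castSucc) (by rw [h₁]; exact hij)
  rw [h₁] at this
  exact this

/-- The coordinate sum of a point is its index, so the east step of `β` with the same abscissa and
height must also have the same index. -/
theorem eastStep_of_height_eq {α β : NEPath k n} (h : α.height = β.height) {j : Fin (k + n)}
    (hp : α.point j.castSucc = β.point j.castSucc)
    (hα : α.point j.succ = α.point j.castSucc + (1, 0)) :
    β.point j.succ = β.point j.castSucc + (1, 0) := by
  obtain ⟨x, y, hxy⟩ : ∃ x y, α.point j.castSucc = (x, y) := ⟨_, _, rfl⟩
  have hle := α.point_le j.succ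
  rw [hα, hxy] at hle
  have hx : x < k := by simpa using hle.1
  have hy : y < n + 1 := by have := hle.2; simp at this; omega
  have hα' : α.height ⟨x, hx⟩ = ⟨y, hy⟩ :=
    α.height_eq_of_eastStep (j := j) hxy (by rw [hα, hxy]; simp)
  rw [h] at hα'
  obtain ⟨l, h₁, h₂⟩ := β.exists_eastStep ⟨x, hx⟩
  rw [hα'] at h₁ h₂
  have e₁ := β.point_fst_add_snd l.castSucc
  have e₂ := α.point_fst_add_snd j.castSucc
  rw [h₁] at e₁
  rw [hxy] at e₂
  have hlj : l = j := by
    apply Fin.ext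
    simp at e₁ e₂
    omega
  subst hlj
  rw [h₁, h₂]
  simp

theorem height_injective : Function.Injective (height : NEPath k n → _) := by
  intro α β h
  refine NEPath.ext (funext fun j => ?_)
  induction j using Fin.induction with
  | zero => rw [α.start, β.start]
  | succ j ih =>
    rcases α.step j with hα | hα
    · rw [hα, eastStep_of_height_eq h ih hα, ih]
    · rcases β.step j with hβ | hβ
      · rw [hβ, eastStep_of_height_eq h.symm ih.symm hβ, ih]
      · rw [hα, hβ, ih]

section ofHeight

variable (h : Fin k → Fin (n + 1))

/-- The abscissa of the `j`-th point of the path with heights `h`. -/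
def abscissa (j : ℕ) : ℕ := (Finset.univ.filter fun i : Fin k => (i : ℕ) + h i < j).card

variable {h}

/-- East step `i` is preceded by `i` east and `h i` north steps, so `i + h i` is its index in the
path. Strictness makes these indices distinct, so counting those below `j` gives the abscissa of
point `j`. -/
theorem strictMono_add_height (hh : Monotone h) : StrictMono fun i : Fin k => (i : ℕ) + h i := by
  intro i j hij
  have h₁ : (h i : ℕ) ≤ h j := hh hij.le
  have h₂ : (i : ℕ) < j := hij
  show (i : ℕ) + h i < j + h j
  omega

theorem abscissa_succ_of_eq (hh : Monotone h) (i : Fin k) :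
    abscissa h ((i : ℕ) + h i) = i ∧ abscissa h ((i : ℕ) + h i + 1) = i + 1 := by
  have hm := strictMono_add_height hh
  constructor
  · rw [abscissa, ← Fin.card_Iio i]
    congr 1
    ext l
    simpa using hm.lt_iff_lt
  · rw [abscissa, ← Fin.card_Iic i]
    congr 1
    ext l
    simpa [Nat.lt_succ_iff] using hm.le_iff_le

theorem abscissa_succ_of_ne {j : ℕ} (hj : ∀ i : Fin k, (i : ℕ) + h i ≠ j) :
    abscissa h (j + 1) = abscissa h j := by
  unfold abscissa
  congr 1
  ext i
  have := hj i
  simp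
  omega

theorem abscissa_zero : abscissa h 0 = 0 := by simp [abscissa]

theorem abscissa_succ (hh : Monotone h) (j : ℕ) :
    abscissa h (j + 1) = abscissa h j + 1 ∨ abscissa h (j + 1) = abscissa h j := by
  by_cases hj : ∃ i : Fin k, (i : ℕ) + h i = j
  · obtain ⟨i, rfl⟩ := hj
    left
    rw [(abscissa_succ_of_eq hh i).1, (abscissa_succ_of_eq hh i).2]
  · push Not at hj
    exact Or.inr (abscissa_succ_of_ne hj)

theorem abscissa_le (hh : Monotone h) (j : ℕ) : abscissa h j ≤ j := by
  induction j with
  | zero => simp [abscissa_zero]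
  | succ j ih => rcases abscissa_succ hh j with h | h <;> omega

theorem abscissa_last : abscissa h (k + n) = k := by
  have : (Finset.univ.filter fun i : Fin k => (i : ℕ) + h i < k + n) = Finset.univ := by
    ext i
    simp
    omega
  rw [abscissa, this, Finset.card_univ, Fintype.card_fin]

/-- The path with prescribed heights. -/
def ofHeight (hh : Monotone h) : NEPath k n where
  point j := (abscissa h j, j - abscissa h j)
  start := by simp [abscissa_zero]
  finish := by simp [abscissa_last]
  step j := by
    have := abscissa_le hh j
    rcases abscissa_succ hh j with h | h
    · left
      simp [h]
    · right
      simp [h]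
      omega

theorem height_ofHeight (hh : Monotone h) : (ofHeight hh).height = h := by
  funext i
  have hlt : (i : ℕ) + h i < k + n := by omega
  obtain ⟨h₁, h₂⟩ := abscissa_succ_of_eq hh i
  refine height_eq_of_eastStep _ (j := ⟨(i : ℕ) + h i, hlt⟩) ?_ ?_
  · simp [ofHeight, h₁]
  · simp [ofHeight, h₂]

end ofHeight

end NEPath

/-- Pairs of weakly increasing sequences `b₁ … b_d` and `a₁ … a_d` with `bᵢ < aᵢ`, that is,
semistandard tableaux of shape `2 × d`. -/
def StandardPair (d m : ℕ) : Type :=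
  {p : (Fin d →o Fin (m + 1)) × (Fin d →o Fin (m + 1)) // ∀ i, p.1 i < p.2 i}

noncomputable instance (d m : ℕ) : Fintype (StandardPair d m) := by
  classical
  have : Finite (Fin d →o Fin (m + 1)) := Finite.of_injective _ DFunLike.coe_injective
  have : Fintype (Fin d →o Fin (m + 1)) := Fintype.ofFinite _
  unfold StandardPair
  infer_instance

/-! ### Polyominoes as semistandard pairs -/

namespace ParallelogramPolyomino

variable {d m : ℕ}

/-- Otherwise the start of the first lower east step would be a point other than the origin on the
line `x = 0`, required to lie strictly below the origin. -/
theorem lower_height_zero (π : ParallelogramPolyomino (d + 1) m) : π.lower.height 0 = 0 := by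
  obtain ⟨j, h₁, -⟩ := π.lower.exists_eastStep 0
  by_contra hne
  have hpos : (π.lower.height 0 : ℕ) ≠ 0 := fun h => hne (Fin.ext h)
  have := π.strictly_below j.castSucc 0 (by rw [h₁, π.upper.start]; simp) (by
    rintro ⟨h0, -⟩
    rw [h0, π.lower.start] at h₁
    exact hpos (Prod.ext_iff.1 h₁).2.symm) (by
    rintro ⟨-, h0⟩
    have := Fin.ext_iff.1 h0
    simp at this
    omega)
  rw [π.upper.start] at this
  simp at this

theorem upper_height_last (π : ParallelogramPolyomino (d + 1) m) :
    π.upper.height (Fin.last d) = Fin.last m := by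
  obtain ⟨j, -, h₂⟩ := π.upper.exists_eastStep (Fin.last d)
  by_contra hne
  have hpos : (π.upper.height (Fin.last d) : ℕ) ≠ m := fun h => hne (Fin.ext h)
  have := π.strictly_below (Fin.last _) j.succ (by rw [h₂, π.lower.finish]; simp) (by
    rintro ⟨h0, -⟩
    simpa using (Fin.ext_iff.1 h0)) (by
    rintro ⟨-, h0⟩
    rw [h0, π.upper.finish] at h₂
    exact hpos (Prod.ext_iff.1 h₂).2.symm)
  rw [π.lower.finish, h₂] at this
  simp at this
  omega

theorem lower_height_lt_upper_height (π : ParallelogramPolyomino (d + 1) m) (i : Fin d) :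
    π.lower.height i.succ < π.upper.height i.castSucc := by
  obtain ⟨j, h₁, -⟩ := π.lower.exists_eastStep i.succ
  obtain ⟨l, -, h₂⟩ := π.upper.exists_eastStep i.castSucc
  have := π.strictly_below j.castSucc l.succ (by rw [h₁, h₂]; simp) (by
    rintro ⟨-, h0⟩
    exact Fin.succ_ne_zero _ h0) (by
    rintro ⟨h0, -⟩
    exact (Fin.castSucc_lt_last j).ne h0)
  rwa [h₁, h₂] at this

/-- The sequences of heights of a polyomino, without the redundant entries `b₀ = 0` and
`a_{d+1} = m`. -/
noncomputable def toStandardPair (π : ParallelogramPolyomino (d + 1) m) : StandardPair d m :=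
  ⟨(⟨fun i => π.lower.height i.succ, fun _ _ h => π.lower.monotone_height (by simpa using h)⟩,
    ⟨fun i => π.upper.height i.castSucc, fun _ _ h => π.upper.monotone_height (by simpa using h)⟩),
    π.lower_height_lt_upper_height⟩

theorem toStandardPair_injective :
    Function.Injective (toStandardPair : ParallelogramPolyomino (d + 1) m → _) := by
  intro π ρ h
  have h' := Subtype.ext_iff.1 h
  have hl := fun i => DFunLike.congr_fun (Prod.ext_iff.1 h').1 i
  have hu := fun i => DFunLike.congr_fun (Prod.ext_iff.1 h').2 i
  refine ParallelogramPolyomino.ext (NEPath.height_injective (funext fun i => ?_))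
    (NEPath.height_injective (funext fun i => ?_))
  · induction i using Fin.lastCases with
    | last => rw [upper_height_last, upper_height_last]
    | cast i => exact hu i
  · induction i using Fin.cases with
    | zero => rw [lower_height_zero, lower_height_zero]
    | succ i => exact hl i

/-- On an interior line `x = c` the highest lower point has height `b_c` and the lowest upper point
has height `a_c`. On the two extreme lines one path meets the line only in the common endpoint. -/
theorem strictly_below_of_height {α β : NEPath (d + 1) m} (h0 : β.height 0 = 0)
    (hlast : α.height (Fin.last d) = Fin.last m)
    (hlt : ∀ i : Fin d, β.height i.succ < α.height i.castSucc) (i j : Fin (d + 1 + m + 1))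
    (hij : (β.point i).1 = (α.point j).1) (hz : ¬ (i = 0 ∧ j = 0))
    (hl : ¬ (i = Fin.last (d + 1 + m) ∧ j = Fin.last (d + 1 + m))) :
    (β.point i).2 < (α.point j).2 := by
  have ei := β.point_fst_add_snd i
  have ej := α.point_fst_add_snd j
  have li := β.point_le i
  rw [Fin.ext_iff, Fin.ext_iff] at hz hl
  simp only [Fin.val_zero, Fin.val_last] at hz hl
  rcases Nat.eq_zero_or_pos (β.point i).1 with hc | hc
  · have := β.le_height_of_fst_le 0 (j := i) (by simp [hc])
    rw [h0] at this
    simp at this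
    omega
  · rcases lt_or_ge (β.point i).1 (d + 1) with hd | hd
    · obtain ⟨c, hc'⟩ : ∃ c, (β.point i).1 = c + 1 := ⟨(β.point i).1 - 1, by omega⟩
      have hcd : c < d := by omega
      have h₁ := β.le_height_of_fst_le (Fin.succ ⟨c, hcd⟩) (j := i) (by simp [hc'])
      have h₂ := α.height_le_of_lt_fst (Fin.castSucc ⟨c, hcd⟩) (j := j)
        (by rw [← hij, hc']; simp)
      have h₃ : (β.height (Fin.succ ⟨c, hcd⟩) : ℕ) < α.height (Fin.castSucc ⟨c, hcd⟩) := hlt _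
      omega
    · have h₂ := α.height_le_of_lt_fst (Fin.last d) (j := j) (by simp; omega)
      rw [hlast] at h₂
      have := li.2
      have := li.1
      have := (α.point_le j).2
      simp at *
      omega

theorem toStandardPair_surjective :
    Function.Surjective (toStandardPair : ParallelogramPolyomino (d + 1) m → _) := by
  rintro ⟨⟨b, a⟩, hab⟩
  have hb : Monotone (Fin.cons 0 b : Fin (d + 1) → Fin (m + 1)) := by
    intro i j hij
    induction i using Fin.cases with
    | zero => simp
    | succ i =>
      induction j using Fin.cases with
      | zero => simp at hij
      | succ j => simpa using b.monotone (by simpa using hij)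
  have ha : Monotone (Fin.snoc a (Fin.last m) : Fin (d + 1) → Fin (m + 1)) := by
    intro i j hij
    induction j using Fin.lastCases with
    | last => simpa using Fin.le_last _
    | cast j =>
      induction i using Fin.lastCases with
      | last => exact absurd hij (not_le.2 (Fin.castSucc_lt_last j))
      | cast i => simpa using a.monotone (by simpa using hij)
  have hab' : ∀ i : Fin d, b i < a i := hab
  refine ⟨⟨NEPath.ofHeight ha, NEPath.ofHeight hb, strictly_below_of_height ?_ ?_ ?_⟩, ?_⟩
  · simp [NEPath.height_ofHeight]
  · simp [NEPath.height_ofHeight]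
  · simpa [NEPath.height_ofHeight] using hab'
  · refine Subtype.ext (Prod.ext ?_ ?_) <;> ext i <;>
      simp [toStandardPair, NEPath.height_ofHeight]

/-- Polyominoes of width `d + 1` and semistandard tableaux with `d` columns are the same. -/
noncomputable def equivStandardPair : ParallelogramPolyomino (d + 1) m ≃ StandardPair d m :=
  Equiv.ofBijective toStandardPair ⟨toStandardPair_injective, toStandardPair_surjective⟩

end ParallelogramPolyomino

/-! ### Counting weakly increasing sequences -/

section MonotoneSequences

variable {d n : ℕ}

noncomputable instance (d n : ℕ) : Fintype (Fin d →o Fin n) :=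
  have : Finite (Fin d →o Fin n) := Finite.of_injective _ DFunLike.coe_injective
  Fintype.ofFinite _

theorem OrderHom.eq_of_ofFn_perm {f g : Fin d →o Fin n}
    (h : (List.ofFn f).Perm (List.ofFn g)) : f = g :=
  OrderHom.ext _ _ (List.ofFn_injective
    (h.eq_of_sortedLE (List.sortedLE_ofFn_iff.2 f.monotone) (List.sortedLE_ofFn_iff.2 g.monotone)))

/-- The multiset of values of a weakly increasing sequence. -/
def OrderHom.toSym (f : Fin d →o Fin n) : Sym (Fin n) d :=
  ⟨(List.ofFn f : Multiset (Fin n)), by simp⟩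

theorem OrderHom.toSym_bijective :
    Function.Bijective (OrderHom.toSym : (Fin d →o Fin n) → Sym (Fin n) d) := by
  constructor
  · intro f g h
    exact OrderHom.eq_of_ofFn_perm (Multiset.coe_eq_coe.1 (Subtype.ext_iff.1 h))
  · rintro ⟨s, hs⟩
    have hl : (s.sort (· ≤ ·)).length = d := by simp [hs]
    subst hl
    refine ⟨⟨(s.sort (· ≤ ·)).get, ?_⟩, Subtype.ext ?_⟩
    · have := (Multiset.pairwise_sort s (· ≤ ·)).sortedLE
      exact this.monotone_get
    · show ((List.ofFn (s.sort (· ≤ ·)).get : List (Fin n)) : Multiset (Fin n)) = s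
      rw [List.ofFn_get, Multiset.sort_eq]

theorem card_orderHom_fin (d n : ℕ) : Fintype.card (Fin d →o Fin n) = n.multichoose d := by
  rw [Fintype.card_of_bijective OrderHom.toSym_bijective, Sym.card_sym_eq_multichoose,
    Fintype.card_fin]

end MonotoneSequences

/-! ### Tail exchange and a lower bound for the number of tableaux -/

section Swap

variable {e n : ℕ}

/-- Exchange of the tails of two sequences at the position `i`: the longer of the new sequences. -/
def tailSwapLong (b a : Fin (e + 1) →o Fin n) (i : Fin (e + 1)) (k : Fin (e + 2)) : Fin n :=
  if h : (k : ℕ) ≤ i then a ⟨k, by omega⟩ else b ⟨k - 1, by omega⟩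

/-- Exchange of the tails of two sequences at the position `i`: the shorter of the new
sequences. -/
def tailSwapShort (b a : Fin (e + 1) →o Fin n) (i : Fin (e + 1)) (k : Fin e) : Fin n :=
  if (k : ℕ) < i then b k.castSucc else a k.succ

/-- The sequence is `a_0, …, a_i, b_i, …, b_e`; the only junction to check is `a_i ≤ b_i`. -/
theorem monotone_tailSwapLong {b a : Fin (e + 1) →o Fin n} {i : Fin (e + 1)} (hi : a i ≤ b i) :
    Monotone (tailSwapLong b a i) := by
  intro k l hkl
  have hkl' : (k : ℕ) ≤ l := hkl
  unfold tailSwapLong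
  split_ifs with h₁ h₂ h₂
  · exact a.monotone hkl
  · refine (a.monotone ?_).trans (hi.trans (b.monotone ?_)) <;> rw [Fin.le_def] <;> simp <;> omega
  · omega
  · apply b.monotone
    rw [Fin.le_def]
    simp
    omega

/-- The sequence is `b_0, …, b_{i-1}, a_{i+1}, …, a_e`; at the junction `b_{i-1} < a_{i-1} ≤
a_{i+1}`. -/
theorem monotone_tailSwapShort {b a : Fin (e + 1) →o Fin n} {i : Fin (e + 1)}
    (hlt : ∀ j < i, b j < a j) : Monotone (tailSwapShort b a i) := by
  intro k l hkl
  have hkl' : (k : ℕ) ≤ l := hkl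
  unfold tailSwapShort
  split_ifs with h₁ h₂ h₂
  · exact b.monotone hkl
  · refine (hlt k.castSucc h₁).le.trans (a.monotone ?_)
    rw [Fin.le_def]
    simp
    omega
  · omega
  · exact a.monotone (by simpa using hkl)

/-- The exchange position can be recovered from the result. If `i < i'`, comparing entries at index
`i` gives `a'_i = a_i ≤ a_{i+1} = b'_i`, although `i` precedes the first crossing of the primed
pair. -/
theorem tailSwap_position_le {b a b' a' : Fin (e + 1) →o Fin n} {i i' : Fin (e + 1)}
    (hlt' : ∀ j < i', b' j < a' j)
    (hL : tailSwapLong b a i = tailSwapLong b' a' i')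
    (hS : tailSwapShort b a i = tailSwapShort b' a' i') : i' ≤ i := by
  by_contra! hii
  have hie : (i : ℕ) < e := by have : (i : ℕ) < i' := hii; omega
  have h₁ := congrFun hL i.castSucc
  have h₂ := congrFun hS ⟨i, hie⟩
  have hii' : (i : ℕ) < i' := hii
  simp [tailSwapLong, hii'.le] at h₁
  simp [tailSwapShort, hii'] at h₂
  have h₃ := hlt' i hii
  have h₄ : a i ≤ a ⟨i + 1, by omega⟩ := a.monotone (by rw [Fin.le_def]; simp)
  rw [h₁, h₂] at h₄
  exact absurd h₃ (not_lt.2 h₄)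

theorem tailSwap_injective {b a b' a' : Fin (e + 1) →o Fin n} {i : Fin (e + 1)}
    (hL : tailSwapLong b a i = tailSwapLong b' a' i)
    (hS : tailSwapShort b a i = tailSwapShort b' a' i) : b = b' ∧ a = a' := by
  constructor
  · refine OrderHom.ext _ _ (funext fun k => ?_)
    rcases lt_or_ge k i with hk | hk
    · have hk' : (k : ℕ) < i := hk
      have := congrFun hS ⟨k, by omega⟩
      simpa [tailSwapShort, hk'] using this
    · have hk' : ¬ (k : ℕ) + 1 ≤ i := by have : (i : ℕ) ≤ k := hk; omega
      have := congrFun hL k.succ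
      simpa [tailSwapLong, hk'] using this
  · refine OrderHom.ext _ _ (funext fun k => ?_)
    rcases le_or_gt k i with hk | hk
    · have hk' : (k : ℕ) ≤ i := hk
      have := congrFun hL k.castSucc
      simpa [tailSwapLong, hk'] using this
    · have hk' : (i : ℕ) < k := hk
      obtain ⟨l, rfl⟩ := Fin.eq_succ_of_ne_zero (Fin.ne_zero_of_lt hk)
      have hl : ¬ (l : ℕ) < i := by simp at hk'; omega
      have := congrFun hS l
      simpa [tailSwapShort, hl] using this

theorem exists_first_crossing {b a : Fin (e + 1) →o Fin n} (h : ¬ ∀ i, b i < a i) :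
    ∃ i, a i ≤ b i ∧ ∀ j < i, b j < a j := by
  push Not at h
  obtain ⟨i, hi, hmin⟩ := WellFounded.has_min (wellFounded_lt (α := Fin (e + 1))) {i | a i ≤ b i} h
  exact ⟨i, hi, fun j hj => not_le.1 fun h' => hmin j h' hj⟩

/-- Pairs that are not standard inject by tail exchange at their first crossing. Surjectivity of the
exchange is not needed, because the reverse inequality follows from the dimension bound. -/
theorem card_mul_card_le_card_standardPair_add (e m : ℕ) :
    (m + 1).multichoose (e + 1) * (m + 1).multichoose (e + 1) ≤
      Fintype.card (StandardPair (e + 1) m) +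
        (m + 1).multichoose (e + 2) * (m + 1).multichoose e := by
  classical
  let P : (Fin (e + 1) →o Fin (m + 1)) × (Fin (e + 1) →o Fin (m + 1)) → Prop :=
    fun p => ∀ i, p.1 i < p.2 i
  have h₁ := Fintype.card_subtype_compl P
  have h₂ := Fintype.card_subtype_le P
  have h₃ : Fintype.card {p // P p} = Fintype.card (StandardPair (e + 1) m) :=
    Fintype.card_congr (Equiv.refl _)
  rw [Fintype.card_prod, card_orderHom_fin] at h₁ h₂
  have h₄ : Fintype.card {p // ¬ P p} ≤
      Fintype.card ((Fin (e + 2) →o Fin (m + 1)) × (Fin e →o Fin (m + 1))) := by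
    choose c hc hlt using fun p : {p // ¬ P p} => exists_first_crossing p.2
    refine Fintype.card_le_of_injective (fun p =>
      (⟨_, monotone_tailSwapLong (hc p)⟩, ⟨_, monotone_tailSwapShort (hlt p)⟩)) ?_
    intro p q hpq
    have hL : tailSwapLong p.1.1 p.1.2 (c p) = tailSwapLong q.1.1 q.1.2 (c q) :=
      congrArg DFunLike.coe (Prod.ext_iff.1 hpq).1
    have hS : tailSwapShort p.1.1 p.1.2 (c p) = tailSwapShort q.1.1 q.1.2 (c q) :=
      congrArg DFunLike.coe (Prod.ext_iff.1 hpq).2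
    have hpos : c p = c q := le_antisymm (tailSwap_position_le (hlt p) hL.symm hS.symm)
      (tailSwap_position_le (hlt q) hL hS)
    rw [hpos] at hL hS
    obtain ⟨h, h'⟩ := tailSwap_injective hL hS
    exact Subtype.ext (Prod.ext h h')
  rw [Fintype.card_prod, card_orderHom_fin, card_orderHom_fin] at h₄
  omega

end Swap

/-! ### Dimensions of bihomogeneous components -/

section Bidegree

variable {n : ℕ}

/-- The weights that give the degree in the first and the degree in the second row of variables. -/
def bidegree (n : ℕ) (p : Fin 2 × Fin n) : ℕ × ℕ := if p.1 = 0 then (1, 0) else (0, 1)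

/-- The bihomogeneous polynomials of degree `a` in the first and `b` in the second row. -/
noncomputable abbrev bihomogeneousSubmodule (n a b : ℕ) :
    Submodule ℂ (MvPolynomial (Fin 2 × Fin n) ℂ) :=
  weightedHomogeneousSubmodule ℂ (bidegree n) (a, b)

theorem weight_bidegree (e : Fin 2 × Fin n →₀ ℕ) :
    Finsupp.weight (bidegree n) e = (∑ j, e (0, j), ∑ j, e (1, j)) := by
  rw [Finsupp.weight_apply, Finsupp.sum_fintype _ _ (by simp), Fintype.sum_prod_type,
    Fin.sum_univ_two]
  ext <;> simp [bidegree, Prod.fst_sum, Prod.snd_sum]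

/-- Exponents of bidegree `(a, b)` are pairs of multisets of column indices. -/
noncomputable def bidegreeExponentEquiv (n a b : ℕ) :
    {e : Fin 2 × Fin n →₀ ℕ | Finsupp.weight (bidegree n) e = (a, b)} ≃
      Sym (Fin n) a × Sym (Fin n) b where
  toFun e := ((Sym.equivNatSumOfFintype (Fin n) a).symm
      ⟨fun j => e.1 (0, j), (Prod.ext_iff.1 ((weight_bidegree e.1).symm.trans e.2)).1⟩,
    (Sym.equivNatSumOfFintype (Fin n) b).symm
      ⟨fun j => e.1 (1, j), (Prod.ext_iff.1 ((weight_bidegree e.1).symm.trans e.2)).2⟩)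
  invFun s := ⟨Finsupp.equivFunOnFinite.symm fun p =>
      if p.1 = 0 then (Sym.equivNatSumOfFintype (Fin n) a s.1).1 p.2
      else (Sym.equivNatSumOfFintype (Fin n) b s.2).1 p.2, by
    refine (weight_bidegree _).trans (Prod.ext ?_ ?_)
    · simp
    · simp⟩
  left_inv e := by
    apply Subtype.ext
    ext ⟨r, j⟩
    fin_cases r <;> simp
  right_inv s := by
    refine Prod.ext ?_ ?_
    · simp only [Equiv.symm_apply_eq]
      exact Subtype.ext (funext fun j => by simp)
    · simp only [Equiv.symm_apply_eq]
      exact Subtype.ext (funext fun j => by simp)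

theorem bihomogeneousSubmodule_eq_restrictSupport (n a b : ℕ) :
    bihomogeneousSubmodule n a b =
      restrictSupport ℂ {e | Finsupp.weight (bidegree n) e = (a, b)} :=
  weightedHomogeneousSubmodule_eq_finsupp_supported ℂ _ _

instance (n a b : ℕ) :
    Finite {e : Fin 2 × Fin n →₀ ℕ | Finsupp.weight (bidegree n) e = (a, b)} :=
  Finite.of_equiv _ (bidegreeExponentEquiv n a b).symm

instance (n a b : ℕ) : FiniteDimensional ℂ (bihomogeneousSubmodule n a b) := by
  rw [bihomogeneousSubmodule_eq_restrictSupport]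
  exact Module.Finite.of_basis (basisRestrictSupport ℂ _)

theorem finrank_bihomogeneousSubmodule (n a b : ℕ) :
    Module.finrank ℂ (bihomogeneousSubmodule n a b) = n.multichoose a * n.multichoose b := by
  rw [bihomogeneousSubmodule_eq_restrictSupport,
    Module.finrank_eq_nat_card_basis (basisRestrictSupport ℂ _),
    Nat.card_congr (bidegreeExponentEquiv n a b), Nat.card_eq_fintype_card, Fintype.card_prod,
    Sym.card_sym_eq_multichoose, Sym.card_sym_eq_multichoose, Fintype.card_fin]

end Bidegree

/-! ### The `sl₂` action by polarization and the upper bound -/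

section Polarization

variable {n : ℕ}

/-- The polarization operator `∑ⱼ X_{r j} ∂/∂X_{s j}`. -/
noncomputable def polarization (n : ℕ) (r s : Fin 2) :
    Derivation ℂ (MvPolynomial (Fin 2 × Fin n) ℂ) (MvPolynomial (Fin 2 × Fin n) ℂ) :=
  ∑ j, (X (r, j) : MvPolynomial (Fin 2 × Fin n) ℂ) • pderiv (s, j)

theorem polarization_apply (r s : Fin 2) (f : MvPolynomial (Fin 2 × Fin n) ℂ) :
    polarization n r s f = ∑ j, X (r, j) * pderiv (s, j) f := by
  have h := congrFun (map_sum Derivation.coeFnAddMonoidHom (fun j : Fin n =>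
    (X (r, j) : MvPolynomial (Fin 2 × Fin n) ℂ) • pderiv (R := ℂ) (s, j)) Finset.univ) f
  rw [Finset.sum_apply] at h
  exact h

theorem polarization_X (r s t : Fin 2) (j : Fin n) :
    polarization n r s (X (t, j)) = if s = t then X (r, j) else 0 := by
  rw [polarization_apply]
  simp only [pderiv_X, Pi.single_apply, Prod.mk.injEq, mul_ite, mul_one, mul_zero]
  split_ifs with h
  · subst h; simp
  · simp [Ne.symm h]

/-- This is the relation `[E, F] = H` of `sl₂`. Both sides are derivations, so it suffices to check
the variables. -/
theorem polarization_commutator (f : MvPolynomial (Fin 2 × Fin n) ℂ) :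
    polarization n 0 1 (polarization n 1 0 f) - polarization n 1 0 (polarization n 0 1 f) =
      polarization n 0 0 f - polarization n 1 1 f := by
  have : ⁅polarization n 0 1, polarization n 1 0⁆ = polarization n 0 0 - polarization n 1 1 := by
    refine MvPolynomial.derivation_ext fun ⟨t, j⟩ => ?_
    rw [Derivation.commutator_apply]
    fin_cases t <;> simp [polarization_X]
  rw [← Derivation.commutator_apply, this, Derivation.sub_apply]

theorem polarization_self_apply_zero {a b : ℕ} {f : MvPolynomial (Fin 2 × Fin n) ℂ}
    (hf : f ∈ bihomogeneousSubmodule n a b) : polarization n 0 0 f = a • f := by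
  have h : f.IsWeightedHomogeneous (fun p : Fin 2 × Fin n => (bidegree n p).1) a := by
    intro e he
    have := congrArg Prod.fst (hf he)
    rw [weight_bidegree] at this
    rw [Finsupp.weight_apply, Finsupp.sum_fintype _ _ (by simp), Fintype.sum_prod_type,
      Fin.sum_univ_two]
    simpa [bidegree] using this
  rw [← h.sum_weight_X_mul_pderiv, polarization_apply, Fintype.sum_prod_type, Fin.sum_univ_two]
  simp [bidegree]

theorem polarization_self_apply_one {a b : ℕ} {f : MvPolynomial (Fin 2 × Fin n) ℂ}
    (hf : f ∈ bihomogeneousSubmodule n a b) : polarization n 1 1 f = b • f := by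
  have h : f.IsWeightedHomogeneous (fun p : Fin 2 × Fin n => (bidegree n p).2) b := by
    intro e he
    have := congrArg Prod.snd (hf he)
    rw [weight_bidegree] at this
    rw [Finsupp.weight_apply, Finsupp.sum_fintype _ _ (by simp), Fintype.sum_prod_type,
      Fin.sum_univ_two]
    simpa [bidegree] using this
  rw [← h.sum_weight_X_mul_pderiv, polarization_apply, Fintype.sum_prod_type, Fin.sum_univ_two]
  simp [bidegree]

theorem polarization_zero_one_mem {a b : ℕ} {f : MvPolynomial (Fin 2 × Fin n) ℂ}
    (hf : f ∈ bihomogeneousSubmodule n a (b + 1)) :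
    polarization n 0 1 f ∈ bihomogeneousSubmodule n (a + 1) b := by
  rw [polarization_apply]
  refine Submodule.sum_mem _ fun j _ => ?_
  have h₁ : (pderiv (1, j) f).IsWeightedHomogeneous (bidegree n) (a, b) :=
    IsWeightedHomogeneous.pderiv hf (by simp [bidegree])
  have h₂ := (isWeightedHomogeneous_X ℂ (bidegree n) (0, j)).mul h₁
  rw [mem_weightedHomogeneousSubmodule]
  convert h₂ using 1
  simp [bidegree, add_comm]

theorem polarization_one_zero_mem {a b : ℕ} {f : MvPolynomial (Fin 2 × Fin n) ℂ}
    (hf : f ∈ bihomogeneousSubmodule n (a + 1) b) :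
    polarization n 1 0 f ∈ bihomogeneousSubmodule n a (b + 1) := by
  rw [polarization_apply]
  refine Submodule.sum_mem _ fun j _ => ?_
  have h₁ : (pderiv (0, j) f).IsWeightedHomogeneous (bidegree n) (a, b) :=
    IsWeightedHomogeneous.pderiv hf (by simp [bidegree])
  have h₂ := (isWeightedHomogeneous_X ℂ (bidegree n) (1, j)).mul h₁
  rw [mem_weightedHomogeneousSubmodule]
  convert h₂ using 1
  simp [bidegree, add_comm]

theorem polarization_zero_one_eq_zero {a : ℕ} {f : MvPolynomial (Fin 2 × Fin n) ℂ}
    (hf : f ∈ bihomogeneousSubmodule n a 0) : polarization n 0 1 f = 0 := by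
  rw [polarization_apply]
  refine Finset.sum_eq_zero fun j _ => ?_
  rw [pderiv_eq_zero_of_notMem_vars, mul_zero]
  intro hj
  obtain ⟨e, he, hje⟩ := (mem_vars_iff_mem_support _).1 hj
  have := congrArg Prod.snd (hf (mem_support_iff.1 he))
  rw [weight_bidegree] at this
  simp at this
  exact (Finsupp.mem_support_iff.1 hje) (this j)

theorem polarization_commutator_of_mem {a b : ℕ} {f : MvPolynomial (Fin 2 × Fin n) ℂ}
    (hf : f ∈ bihomogeneousSubmodule n a b) :
    polarization n 1 0 (polarization n 0 1 f) =
      polarization n 0 1 (polarization n 1 0 f) - ((a : ℂ) - b) • f := by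
  have := polarization_commutator f
  rw [polarization_self_apply_zero hf, polarization_self_apply_one hf,
    ← Nat.cast_smul_eq_nsmul ℂ, ← Nat.cast_smul_eq_nsmul ℂ, ← sub_smul] at this
  rw [← this]
  abel

/-- With `E = polarization n 0 1` and `F = polarization n 1 0`: in nonnegative weight `FE` has no
negative integer eigenvalue. If `FEf = -l f`, the commutator makes `Ef` an eigenvector with a still
more negative eigenvalue, in lower degree in the second row. By induction `Ef = 0`, whence `l f =
0`. -/
theorem eq_zero_of_polarization_eq_neg_smul (b : ℕ) : ∀ (a l : ℕ), b ≤ a → 0 < l →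
    ∀ f ∈ bihomogeneousSubmodule n a b,
      polarization n 1 0 (polarization n 0 1 f) = -(l : ℂ) • f → f = 0 := by
  induction b with
  | zero =>
    intro a l _ hl f hf h
    rw [polarization_zero_one_eq_zero hf, map_zero] at h
    have : (l : ℂ) ≠ 0 := by exact_mod_cast hl.ne'
    simpa [this] using h.symm
  | succ b ih =>
    intro a l hab hl f hf h
    have h' : polarization n 0 1 f = 0 := by
      refine ih (a + 1) (l + (a + 1 - b)) (by omega) (by omega) _
        (polarization_zero_one_mem hf) ?_
      rw [polarization_commutator_of_mem (polarization_zero_one_mem hf), h,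
        Derivation.map_smul, ← sub_smul]
      congr 1
      have : b ≤ a + 1 := by omega
      push_cast [Nat.cast_sub this]
      ring
    rw [h', map_zero] at h
    have : (l : ℂ) ≠ 0 := by exact_mod_cast hl.ne'
    simpa [this] using h.symm

/-- On bidegree `(e + 2, e)` the operator `EF` is injective, hence surjective by finite dimension; a
preimage under `E` is then found in the image of `F`. -/
theorem exists_polarization_eq (e : ℕ) {g : MvPolynomial (Fin 2 × Fin n) ℂ}
    (hg : g ∈ bihomogeneousSubmodule n (e + 2) e) :
    ∃ f ∈ bihomogeneousSubmodule n (e + 1) (e + 1), polarization n 0 1 f = g := by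
  let T : bihomogeneousSubmodule n (e + 2) e →ₗ[ℂ] bihomogeneousSubmodule n (e + 2) e :=
    ((polarization n 0 1).toLinearMap ∘ₗ (polarization n 1 0).toLinearMap).restrict
      fun f hf => polarization_zero_one_mem (polarization_one_zero_mem hf)
  have hT : Function.Injective T := by
    rw [injective_iff_map_eq_zero]
    rintro ⟨f, hf⟩ h
    have h' : polarization n 0 1 (polarization n 1 0 f) = 0 := congrArg Subtype.val h
    -- The eigenvalue is `-2` because `EFf = 0` leaves `FEf = -((e + 2) - e) f`.
    refine Subtype.ext (eq_zero_of_polarization_eq_neg_smul e (e + 2) 2 (by omega) (by omega) f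
      hf ?_)
    rw [polarization_commutator_of_mem hf, h', zero_sub, ← neg_smul]
    congr 1
    push_cast
    ring
  obtain ⟨f, hf⟩ := LinearMap.surjective_of_injective hT ⟨g, hg⟩
  exact ⟨_, polarization_one_zero_mem f.2, congrArg Subtype.val hf⟩

theorem finrank_le_of_polarization_eq_zero (e : ℕ)
    {W : Submodule ℂ (MvPolynomial (Fin 2 × Fin n) ℂ)}
    (hW : W ≤ bihomogeneousSubmodule n (e + 1) (e + 1))
    (hker : ∀ f ∈ W, polarization n 0 1 f = 0) :
    Module.finrank ℂ W + n.multichoose (e + 2) * n.multichoose e ≤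
      n.multichoose (e + 1) * n.multichoose (e + 1) := by
  let T : bihomogeneousSubmodule n (e + 1) (e + 1) →ₗ[ℂ] bihomogeneousSubmodule n (e + 2) e :=
    (polarization n 0 1).toLinearMap.restrict fun f hf => polarization_zero_one_mem hf
  have hT : LinearMap.range T = ⊤ := by
    rw [LinearMap.range_eq_top]
    rintro ⟨g, hg⟩
    obtain ⟨f, hf, hfg⟩ := exists_polarization_eq e hg
    exact ⟨⟨f, hf⟩, Subtype.ext hfg⟩
  have h := LinearMap.finrank_range_add_finrank_ker T
  rw [hT, finrank_top, finrank_bihomogeneousSubmodule, finrank_bihomogeneousSubmodule] at h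
  have hWT : Module.finrank ℂ W ≤ Module.finrank ℂ (LinearMap.ker T) := by
    let ι : W →ₗ[ℂ] LinearMap.ker T := (Submodule.inclusion hW).codRestrict _
      fun f => LinearMap.mem_ker.2 (Subtype.ext (hker f f.2))
    refine LinearMap.finrank_le_finrank_of_injective (f := ι) fun f g hfg => ?_
    exact Subtype.ext (congrArg (fun x => (x.1.1 : MvPolynomial (Fin 2 × Fin n) ℂ)) hfg)
  omega

end Polarization

/-! ### Invariants: torus weights, unipotent substitutions, grading -/

section Invariants

variable {n : ℕ}

theorem leftSubst_X (g : Matrix.SpecialLinearGroup (Fin 2) ℂ) (r : Fin 2) (j : Fin n) :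
    leftSubst n g (X (r, j)) = C (g.1 r 0) * X (0, j) + C (g.1 r 1) * X (1, j) := by
  simp [leftSubst, Matrix.mul_apply, Fin.sum_univ_two, Matrix.mvPolynomialX]

theorem coeff_aeval_C_mul_X {σ R : Type*} [Fintype σ] [CommSemiring R] (c : σ → R)
    (f : MvPolynomial σ R) (e : σ →₀ ℕ) :
    coeff e (aeval (fun p => C (c p) * X p : σ → MvPolynomial σ R) f) =
      (∏ p, c p ^ e p) * coeff e f := by
  classical
  induction f using MvPolynomial.induction_on' with
  | monomial s a =>
    have : aeval (fun p => C (c p) * X p : σ → MvPolynomial σ R) (monomial s a) =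
        C (a * ∏ p, c p ^ s p) * monomial s 1 := by
      rw [aeval_monomial, Finsupp.prod_fintype _ _ (by simp)]
      simp only [mul_pow, Finset.prod_mul_distrib]
      rw [monomial_eq, Finsupp.prod_fintype _ _ (by simp), algebraMap_eq, C_mul, map_prod]
      simp only [map_pow, C_1, one_mul]
      ring
    rw [this, coeff_C_mul, coeff_monomial, coeff_monomial]
    split_ifs with h
    · subst h; ring
    · simp
  | add p q hp hq => rw [map_add, coeff_add, hp, hq, coeff_add, mul_add]

theorem sum_eq_sum_of_mem_invariantRing {f : MvPolynomial (Fin 2 × Fin n) ℂ}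
    (hf : f ∈ invariantRing n) {e : Fin 2 × Fin n →₀ ℕ} (he : coeff e f ≠ 0) :
    ∑ j, e (0, j) = ∑ j, e (1, j) := by
  -- This torus element multiplies a monomial by `2` to the difference of its row degrees; since `2`
  -- is not a root of unity, one such element suffices.
  let g : Matrix.SpecialLinearGroup (Fin 2) ℂ :=
    ⟨!![2, 0; 0, 1 / 2], by simp [Matrix.det_fin_two]⟩
  let c : Fin 2 × Fin n → ℂ := fun p => if p.1 = 0 then 2 else 1 / 2
  have hg : leftSubst n g = aeval (fun p => C (c p) * X p) := by
    refine algHom_ext fun ⟨r, j⟩ => ?_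
    rw [leftSubst_X, aeval_X]
    fin_cases r <;> simp [g, c]
  have h := congrArg (coeff e) (hf g)
  rw [hg, coeff_aeval_C_mul_X] at h
  have h₁ := mul_right_cancel₀ he (h.trans (one_mul _).symm)
  rw [Fintype.prod_prod_type, Fin.prod_univ_two] at h₁
  simp only [c, if_true, one_ne_zero, if_false, one_div, inv_pow, Finset.prod_inv_distrib,
    Finset.prod_pow_eq_pow_sum] at h₁
  have h₂ := (mul_inv_eq_one₀ (pow_ne_zero _ two_ne_zero)).1 h₁
  exact Nat.pow_right_injective le_rfl (by exact_mod_cast h₂)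

theorem invariantComponent_le_bihomogeneousSubmodule (n d : ℕ) :
    invariantComponent n d ≤ bihomogeneousSubmodule n d d := by
  rintro f ⟨hf, hd⟩ e he
  have h₁ := sum_eq_sum_of_mem_invariantRing hf he
  have h₂ : e.degree = 2 * d := by
    rw [Finsupp.degree_eq_weight_one]
    exact hd he
  rw [Finsupp.degree_eq_sum, Fintype.sum_prod_type,
    Fin.sum_univ_two] at h₂
  rw [weight_bidegree]
  ext <;> simp only <;> omega

/-- The generic unipotent substitution `x ↦ x`, `y ↦ y + t x`. -/
noncomputable def unipotentSubst (n : ℕ) :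
    MvPolynomial (Fin 2 × Fin n) ℂ →ₐ[ℂ] Polynomial (MvPolynomial (Fin 2 × Fin n) ℂ) :=
  aeval fun p => Polynomial.C (X p) +
    if p.1 = 1 then Polynomial.X * Polynomial.C (X (0, p.2)) else 0

/-- The coefficient of `t` is the infinitesimal action of the unipotent subgroup; both it and `E`
obey the Leibniz rule. -/
theorem coeff_unipotentSubst (f : MvPolynomial (Fin 2 × Fin n) ℂ) :
    (unipotentSubst n f).coeff 0 = f ∧ (unipotentSubst n f).coeff 1 = polarization n 0 1 f := by
  induction f using MvPolynomial.induction_on with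
  | C a =>
    have : unipotentSubst n (C a) = Polynomial.C (C a) := by
      rw [← algebraMap_eq, AlgHom.commutes]
      rfl
    rw [this]
    simp
  | add p q hp hq => simp [hp, hq]
  | mul_X p i hp =>
    obtain ⟨r, j⟩ := i
    have h₀ : (unipotentSubst n (X (r, j))).coeff 0 = X (r, j) := by
      fin_cases r <;> simp [unipotentSubst]
    have h₁ : (unipotentSubst n (X (r, j))).coeff 1 = polarization n 0 1 (X (r, j)) := by
      fin_cases r <;> simp [unipotentSubst, polarization_X]
    rw [map_mul, Polynomial.mul_coeff_zero, Polynomial.mul_coeff_one, hp.1, hp.2, h₀, h₁,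
      Derivation.leibniz]
    refine ⟨rfl, ?_⟩
    simp only [smul_eq_mul]
    ring

/-- The matrix of the substitution `x ↦ x`, `y ↦ y + t x`. -/
noncomputable def lowerUnipotent (t : ℂ) : Matrix.SpecialLinearGroup (Fin 2) ℂ :=
  ⟨!![1, 0; t, 1], by simp [Matrix.det_fin_two]⟩

theorem eval_unipotentSubst (t : ℂ) (f : MvPolynomial (Fin 2 × Fin n) ℂ) :
    (unipotentSubst n f).eval (C t) =
      leftSubst n (lowerUnipotent t) f := by
  induction f using MvPolynomial.induction_on with
  | C a =>
    rw [← algebraMap_eq, AlgHom.commutes, AlgHom.commutes]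
    exact Polynomial.eval_C
  | add p q hp hq => rw [map_add, map_add, Polynomial.eval_add, hp, hq]
  | mul_X p i hp =>
    obtain ⟨r, j⟩ := i
    rw [map_mul, map_mul, Polynomial.eval_mul, hp, leftSubst_X]
    congr 1
    fin_cases r
    · simp [unipotentSubst, lowerUnipotent]
    · simp [unipotentSubst, lowerUnipotent]
      ring

/-- As a polynomial in `t`, the substituted `f` takes the value `f` at infinitely many constants, so
it is constant and its linear coefficient vanishes. -/
theorem polarization_eq_zero_of_mem_invariantRing {f : MvPolynomial (Fin 2 × Fin n) ℂ}
    (hf : f ∈ invariantRing n) : polarization n 0 1 f = 0 := by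
  have h : unipotentSubst n f = Polynomial.C f := by
    refine Polynomial.eq_of_infinite_eval_eq _ _ ?_
    refine (Set.infinite_range_of_injective (C_injective (Fin 2 × Fin n) ℂ)).mono ?_
    rintro _ ⟨t, rfl⟩
    rw [Set.mem_ofPred, eval_unipotentSubst, hf, Polynomial.eval_C]
  rw [← (coeff_unipotentSubst f).2, h, Polynomial.coeff_C_succ]

theorem isHomogeneous_leftSubst (g : Matrix.SpecialLinearGroup (Fin 2) ℂ) {k : ℕ}
    {f : MvPolynomial (Fin 2 × Fin n) ℂ} (hf : f.IsHomogeneous k) :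
    (leftSubst n g f).IsHomogeneous k := by
  rw [← one_mul k]
  refine hf.aeval _ fun ⟨r, j⟩ => ?_
  have h := leftSubst_X g r j
  rw [leftSubst, aeval_X] at h
  rw [h]
  exact (isHomogeneous_C_mul_X _ _).add (isHomogeneous_C_mul_X _ _)

theorem homogeneousComponent_leftSubst (g : Matrix.SpecialLinearGroup (Fin 2) ℂ) (k : ℕ)
    (f : MvPolynomial (Fin 2 × Fin n) ℂ) :
    homogeneousComponent k (leftSubst n g f) = leftSubst n g (homogeneousComponent k f) := by
  conv_lhs => rw [← sum_homogeneousComponent f, map_sum, map_sum]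
  have h : ∀ i, homogeneousComponent k (leftSubst n g (homogeneousComponent i f)) =
      if k = i then leftSubst n g (homogeneousComponent i f) else 0 := fun i =>
    homogeneousComponent_of_mem
      (isHomogeneous_leftSubst g (homogeneousComponent_isHomogeneous i f))
  simp only [h, Finset.sum_ite_eq, Finset.mem_range]
  split_ifs with hk
  · rfl
  · rw [homogeneousComponent_eq_zero _ _ (by omega), map_zero]

theorem iSupIndep_invariantComponent (n : ℕ) : iSupIndep (invariantComponent n) := by
  have h : iSupIndep (homogeneousSubmodule (Fin 2 × Fin n) ℂ) :=
    letI := decomposition (σ := Fin 2 × Fin n) (R := ℂ)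
    (DirectSum.Decomposition.isInternal (homogeneousSubmodule (Fin 2 × Fin n) ℂ)).submodule_iSupIndep
  have h₂ : Function.Injective fun d : ℕ => 2 * d := fun a b h => by simpa using h
  exact (h.comp h₂).mono fun d => inf_le_right

/-- Substitution preserves degree, so homogeneous components of invariants are invariant. A nonzero
one has equal row degrees, hence even total degree. -/
theorem iSup_invariantComponent (n : ℕ) :
    ⨆ d : ℕ, invariantComponent n d = Subalgebra.toSubmodule (invariantRing n) := by
  refine le_antisymm (iSup_le fun d => inf_le_left) fun f hf => ?_
  have hf' : f ∈ invariantRing n := hf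
  rw [← sum_homogeneousComponent f]
  refine Submodule.sum_mem _ fun k _ => ?_
  have hk : homogeneousComponent k f ∈ invariantRing n := fun g => by
    rw [← homogeneousComponent_leftSubst, hf' g]
  by_cases h0 : homogeneousComponent k f = 0
  · rw [h0]
    exact Submodule.zero_mem _
  · obtain ⟨e, he⟩ := ne_zero_iff.1 h0
    have h₁ := sum_eq_sum_of_mem_invariantRing hk he
    have h₂ : e.degree = k := by
      rw [Finsupp.degree_eq_weight_one]
      exact homogeneousComponent_isHomogeneous k f he
    rw [Finsupp.degree_eq_sum, Fintype.sum_prod_type,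
      Fin.sum_univ_two, h₁, ← two_mul] at h₂
    refine Submodule.mem_iSup_of_mem (∑ j, e (1, j)) ⟨hk, ?_⟩
    rw [SetLike.mem_coe, h₂]
    exact homogeneousComponent_isHomogeneous k f

theorem columnMinor_eq (i j : Fin n) :
    columnMinor i j = X (0, i) * X (1, j) - X (0, j) * X (1, i) := by
  simp [columnMinor, Matrix.det_fin_two, Matrix.mvPolynomialX]

theorem columnMinor_mem_invariantRing (i j : Fin n) : columnMinor i j ∈ invariantRing n := by
  intro g
  have hdet : g.1 0 0 * g.1 1 1 - g.1 0 1 * g.1 1 0 = 1 := by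
    rw [← Matrix.det_fin_two, g.2]
  have h := congrArg (C : ℂ → MvPolynomial (Fin 2 × Fin n) ℂ) hdet
  simp only [map_sub, map_mul, map_one] at h
  rw [columnMinor_eq]
  simp only [map_sub, map_mul, leftSubst_X]
  linear_combination (X (0, i) * X (1, j) - X (0, j) * X (1, i)) * h

theorem isHomogeneous_columnMinor (i j : Fin n) : (columnMinor i j).IsHomogeneous 2 := by
  rw [columnMinor_eq]
  exact ((isHomogeneous_X _ _).mul (isHomogeneous_X _ _)).sub
    ((isHomogeneous_X _ _).mul (isHomogeneous_X _ _))

theorem prod_columnMinor_mem_invariantComponent {d : ℕ} (b a : Fin d → Fin n) :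
    ∏ i, columnMinor (b i) (a i) ∈ invariantComponent n d := by
  refine ⟨Subalgebra.prod_mem _ fun i _ => columnMinor_mem_invariantRing _ _, ?_⟩
  have := IsHomogeneous.prod Finset.univ (fun i => columnMinor (b i) (a i)) (fun _ => 2)
    fun i _ => isHomogeneous_columnMinor _ _
  rw [SetLike.mem_coe, mem_homogeneousSubmodule]
  simpa [mul_comm] using this

instance (n d : ℕ) : FiniteDimensional ℂ (invariantComponent n d) :=
  Submodule.finiteDimensional_of_le (invariantComponent_le_bihomogeneousSubmodule n d)

end Invariants

/-! ### Leading monomials for an additive weight -/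

section LeadingExponent

variable {σ R : Type*} [CommRing R]

/-- The monomial with exponent `e` has coefficient `1` in `f`, and its weight exceeds the weight of
every other monomial of `f`. -/
def HasLeadingExponent (w : (σ →₀ ℕ) →+ ℕ) (f : MvPolynomial σ R) (e : σ →₀ ℕ) : Prop :=
  coeff e f = 1 ∧ ∀ e', e' ≠ e → coeff e' f ≠ 0 → w e' < w e

theorem hasLeadingExponent_one (w : (σ →₀ ℕ) →+ ℕ) :
    HasLeadingExponent w (1 : MvPolynomial σ R) 0 := by
  classical
  refine ⟨by simp, fun e' he' h => absurd ?_ h⟩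
  rw [coeff_one, if_neg (Ne.symm he')]

/-- No total monomial order is needed: by additivity of `w`, every pair of monomials other than the
two leading ones has strictly smaller total weight. -/
theorem HasLeadingExponent.mul {w : (σ →₀ ℕ) →+ ℕ} {f g : MvPolynomial σ R} {e e' : σ →₀ ℕ}
    (hf : HasLeadingExponent w f e) (hg : HasLeadingExponent w g e') :
    HasLeadingExponent w (f * g) (e + e') := by
  classical
  have key : ∀ x y, coeff x f * coeff y g ≠ 0 → (x, y) ≠ (e, e') → w (x + y) < w (e + e') := by
    intro x y h hne
    have hx := left_ne_zero_of_mul h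
    have hy := right_ne_zero_of_mul h
    rw [map_add, map_add]
    by_cases hxe : x = e
    · subst hxe
      have := hg.2 y (fun hye => hne (by rw [hye])) hy
      omega
    · have h₁ := hf.2 x hxe hx
      by_cases hye : y = e'
      · subst hye
        omega
      · have := hg.2 y hye hy
        omega
  refine ⟨?_, fun s hs h => ?_⟩
  · rw [coeff_mul, Finset.sum_eq_single (e, e')]
    · rw [hf.1, hg.1, one_mul]
    · rintro ⟨x, y⟩ hxy hne
      by_contra h
      have := key x y h hne
      rw [Finset.HasAntidiagonal.mem_antidiagonal.1 hxy] at this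
      exact lt_irrefl _ this
    · intro h
      simp at h
  · rw [coeff_mul] at h
    obtain ⟨⟨x, y⟩, hxy, hne⟩ := Finset.exists_ne_zero_of_sum_ne_zero h
    have hxy' : x + y = s := Finset.HasAntidiagonal.mem_antidiagonal.1 hxy
    rw [← hxy']
    refine key x y hne fun heq => hs ?_
    obtain ⟨rfl, rfl⟩ := Prod.mk.inj heq
    exact hxy'.symm

theorem HasLeadingExponent.prod {ι : Type*} {w : (σ →₀ ℕ) →+ ℕ} (s : Finset ι)
    {f : ι → MvPolynomial σ R} {e : ι → σ →₀ ℕ} (h : ∀ i, HasLeadingExponent w (f i) (e i)) :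
    HasLeadingExponent w (∏ i ∈ s, f i) (∑ i ∈ s, e i) := by
  classical
  induction s using Finset.induction_on with
  | empty => simpa using hasLeadingExponent_one w
  | insert i s hi ih =>
    rw [Finset.prod_insert hi, Finset.sum_insert hi]
    exact (h i).mul ih

/-- In a relation, take a term of maximal leading weight. Its leading monomial occurs in no other
term, since such a term would have a larger leading weight. -/
theorem linearIndependent_of_hasLeadingExponent {ι : Type*} {w : (σ →₀ ℕ) →+ ℕ}
    {f : ι → MvPolynomial σ R} {e : ι → σ →₀ ℕ} (he : Function.Injective e)
    (h : ∀ i, HasLeadingExponent w (f i) (e i)) : LinearIndependent R f := by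
  classical
  rw [linearIndependent_iff']
  intro s c hc i hi
  by_contra hne
  obtain ⟨k, hk, hmax⟩ := Finset.exists_max_image (s.filter fun i => c i ≠ 0) (fun i => w (e i))
    ⟨i, Finset.mem_filter.2 ⟨hi, hne⟩⟩
  rw [Finset.mem_filter] at hk
  have hcoeff := congrArg (coeff (e k)) hc
  rw [coeff_sum, coeff_zero, Finset.sum_eq_single k] at hcoeff
  · rw [coeff_smul, (h k).1, smul_eq_mul, mul_one] at hcoeff
    exact hk.2 hcoeff
  · intro l hl hlk
    rw [coeff_smul, smul_eq_mul]
    by_contra hmul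
    have h₁ := (h l).2 (e k) (fun h => hlk (he h).symm) (right_ne_zero_of_mul hmul)
    have h₂ := hmax l (Finset.mem_filter.2 ⟨hl, left_ne_zero_of_mul hmul⟩)
    omega
  · intro h
    exact absurd hk.1 h

end LeadingExponent

/-! ### Independence of the minor monomials and comparison of the bounds -/

section StandardMonomials

variable {n d m : ℕ}

/-- The sum of the column indices of the variables in the second row. -/
noncomputable def columnWeight (n : ℕ) : (Fin 2 × Fin n →₀ ℕ) →+ ℕ :=
  Finsupp.weight fun p => if p.1 = 0 then 0 else (p.2 : ℕ)

theorem columnWeight_single_add_single (i j : Fin n) :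
    columnWeight n (Finsupp.single (0, i) 1 + Finsupp.single (1, j) 1) = j := by
  rw [columnWeight, map_add, Finsupp.weight_single, Finsupp.weight_single]
  simp

theorem hasLeadingExponent_columnMinor {i j : Fin n} (hij : i < j) :
    HasLeadingExponent (columnWeight n) (columnMinor i j)
      (Finsupp.single (0, i) 1 + Finsupp.single (1, j) 1) := by
  classical
  have h : columnMinor i j =
      monomial (Finsupp.single (0, i) 1 + Finsupp.single (1, j) 1) 1 -
        monomial (Finsupp.single (0, j) 1 + Finsupp.single (1, i) 1) 1 := by
    rw [columnMinor_eq, X, X, X, X, monomial_mul, monomial_mul, one_mul]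
  have hne : (Finsupp.single (0, j) 1 + Finsupp.single (1, i) 1 : Fin 2 × Fin n →₀ ℕ) ≠
      Finsupp.single (0, i) 1 + Finsupp.single (1, j) 1 := fun h => by
    have := congrArg (columnWeight n) h
    rw [columnWeight_single_add_single, columnWeight_single_add_single] at this
    have hij' : (i : ℕ) < j := hij
    omega
  constructor
  · rw [h, coeff_sub, coeff_monomial, coeff_monomial, if_pos rfl, if_neg hne, sub_zero]
  · intro e' he' hc
    rw [h, coeff_sub, coeff_monomial, coeff_monomial, if_neg (Ne.symm he'), zero_sub] at hc
    have : Finsupp.single (0, j) 1 + Finsupp.single (1, i) 1 = e' := by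
      by_contra h'
      simp [h'] at hc
    rw [← this, columnWeight_single_add_single, columnWeight_single_add_single]
    exact hij

/-- The exponent of the leading monomial of the product of the minors on the columns
`bᵢ`, `aᵢ`. -/
noncomputable def pairExponent (b a : Fin d → Fin n) : Fin 2 × Fin n →₀ ℕ :=
  ∑ i, (Finsupp.single (0, b i) 1 + Finsupp.single (1, a i) 1)

theorem pairExponent_apply_zero (b a : Fin d → Fin n) (j : Fin n) :
    pairExponent b a (0, j) = (Finset.univ.val.map b).count j := by
  rw [Multiset.count_map, pairExponent, Finsupp.finsetSum_apply]
  simp only [Finsupp.add_apply, Finsupp.single_apply, Prod.mk.injEq, true_and, one_ne_zero,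
    false_and, if_false, add_zero]
  rw [Finset.sum_boole]
  simp [Finset.card_def, eq_comm]

theorem pairExponent_apply_one (b a : Fin d → Fin n) (j : Fin n) :
    pairExponent b a (1, j) = (Finset.univ.val.map a).count j := by
  rw [Multiset.count_map, pairExponent, Finsupp.finsetSum_apply]
  simp only [Finsupp.add_apply, Finsupp.single_apply, Prod.mk.injEq, true_and, zero_ne_one,
    false_and, if_false, zero_add]
  rw [Finset.sum_boole]
  simp [Finset.card_def, eq_comm]

theorem OrderHom.eq_of_map_univ_eq {f g : Fin d →o Fin n}
    (h : Finset.univ.val.map f = Finset.univ.val.map g) : f = g := by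
  rw [Fin.univ_val_map, Fin.univ_val_map] at h
  exact OrderHom.eq_of_ofFn_perm (Multiset.coe_eq_coe.1 h)

/-- The exponent records the multisets of the values `b_i` and `a_i`, and a weakly increasing
sequence is determined by its multiset of values. -/
theorem pairExponent_injective :
    Function.Injective fun p : StandardPair d m => pairExponent p.1.1 p.1.2 := by
  intro p q h
  refine Subtype.ext (Prod.ext (OrderHom.eq_of_map_univ_eq (Multiset.ext' fun j => ?_))
    (OrderHom.eq_of_map_univ_eq (Multiset.ext' fun j => ?_)))
  · rw [← pairExponent_apply_zero _ p.1.2, ← pairExponent_apply_zero _ q.1.2]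
    exact DFunLike.congr_fun h _
  · rw [← pairExponent_apply_one p.1.1, ← pairExponent_apply_one q.1.1]
    exact DFunLike.congr_fun h _

theorem linearIndependent_minorMonomial (d m : ℕ) :
    LinearIndependent ℂ (fun π : ParallelogramPolyomino (d + 1) m => π.minorMonomial) :=
  linearIndependent_of_hasLeadingExponent
    (pairExponent_injective.comp ParallelogramPolyomino.toStandardPair_injective)
    fun π => HasLeadingExponent.prod _
      fun i => hasLeadingExponent_columnMinor (π.lower_height_lt_upper_height i)

noncomputable instance (k n : ℕ) : Fintype (ParallelogramPolyomino k n) := Fintype.ofFinite _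

theorem card_standardPair (d m : ℕ) :
    Fintype.card (StandardPair d m) = Fintype.card (ParallelogramPolyomino (d + 1) m) :=
  (Fintype.card_congr ParallelogramPolyomino.equivStandardPair).symm

theorem span_minorMonomial_le (d m : ℕ) :
    Submodule.span ℂ (Set.range fun π : ParallelogramPolyomino (d + 1) m => π.minorMonomial) ≤
      invariantComponent (m + 1) d := by
  rw [Submodule.span_le]
  rintro _ ⟨π, rfl⟩
  exact prod_columnMinor_mem_invariantComponent _ _

theorem card_le_finrank_invariantComponent (d m : ℕ) :
    Fintype.card (ParallelogramPolyomino (d + 1) m) ≤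
      Module.finrank ℂ (invariantComponent (m + 1) d) := by
  rw [← finrank_span_eq_card (linearIndependent_minorMonomial d m)]
  exact Submodule.finrank_mono (span_minorMonomial_le d m)

theorem finrank_invariantComponent_succ_add_le (d m : ℕ) :
    Module.finrank ℂ (invariantComponent (m + 1) (d + 1)) +
        (m + 1).multichoose (d + 2) * (m + 1).multichoose d ≤
      (m + 1).multichoose (d + 1) * (m + 1).multichoose (d + 1) :=
  finrank_le_of_polarization_eq_zero d (invariantComponent_le_bihomogeneousSubmodule _ _)
    fun _ hf => polarization_eq_zero_of_mem_invariantRing hf.1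

theorem finrank_invariantComponent_zero (m : ℕ) :
    Module.finrank ℂ (invariantComponent (m + 1) 0) = 1 := by
  apply le_antisymm
  · refine (Submodule.finrank_mono (invariantComponent_le_bihomogeneousSubmodule _ _)).trans ?_
    rw [finrank_bihomogeneousSubmodule]
    simp
  · refine le_trans ?_ (card_le_finrank_invariantComponent 0 m)
    rw [← card_standardPair]
    exact Fintype.card_pos_iff.2 ⟨⟨(⟨Fin.elim0, fun i => i.elim0⟩, ⟨Fin.elim0, fun i => i.elim0⟩),
      fun i => i.elim0⟩⟩

/-- The tail-exchange count and the rank-nullity bound involve the same expression in the `h_k`, so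
the chain of inequalities collapses. -/
theorem card_eq_finrank_invariantComponent (d m : ℕ) :
    Fintype.card (ParallelogramPolyomino (d + 1) m) =
      Module.finrank ℂ (invariantComponent (m + 1) d) := by
  refine le_antisymm (card_le_finrank_invariantComponent d m) ?_
  cases d with
  | zero =>
    rw [finrank_invariantComponent_zero, ← card_standardPair]
    exact Fintype.card_pos_iff.2 ⟨⟨(⟨Fin.elim0, fun i => i.elim0⟩, ⟨Fin.elim0, fun i => i.elim0⟩),
      fun i => i.elim0⟩⟩
  | succ d =>
    have h₁ := finrank_invariantComponent_succ_add_le d m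
    have h₂ := card_mul_card_le_card_standardPair_add d m
    rw [card_standardPair] at h₂
    omega

theorem span_minorMonomial (d m : ℕ) :
    Submodule.span ℂ (Set.range fun π : ParallelogramPolyomino (d + 1) m => π.minorMonomial) =
      invariantComponent (m + 1) d := by
  refine Submodule.eq_of_le_of_finrank_eq (span_minorMonomial_le d m) ?_
  rw [finrank_span_eq_card (linearIndependent_minorMonomial d m),
    card_eq_finrank_invariantComponent]

theorem finrank_invariantComponent_succ_add (d m : ℕ) :
    Module.finrank ℂ (invariantComponent (m + 1) (d + 1)) +
        (m + 1).multichoose (d + 2) * (m + 1).multichoose d =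
      (m + 1).multichoose (d + 1) * (m + 1).multichoose (d + 1) := by
  refine le_antisymm (finrank_invariantComponent_succ_add_le d m) ?_
  rw [← card_eq_finrank_invariantComponent, ← card_standardPair]
  exact card_mul_card_le_card_standardPair_add d m

end StandardMonomials

/-! ### Recursion for the dimensions -/

section Narayana

/-- The recursion satisfied by the numbers `h_d² - h_{d+1} h_{d-1}`, where `h_d` is the number of
multisets of size `d` in a set with `m + 1` elements. -/
theorem finrank_invariantComponent_recursion (d m : ℕ) :
    ((d : ℚ) + 1) * (d + 2) * Module.finrank ℂ (invariantComponent (m + 1) (d + 1)) =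
      (d + m + 1) * (d + m) * Module.finrank ℂ (invariantComponent (m + 1) d) := by
  have hrec : ∀ k : ℕ, ((k : ℚ) + 1) * (m + 1).multichoose (k + 1) =
      (m + k + 1) * (m + 1).multichoose k := by
    intro k
    have h₁ := Nat.add_one_mul_choose_eq (m + k) k
    have h₂ : (m + 1).multichoose (k + 1) = (m + k + 1).choose (k + 1) := by
      rw [Nat.multichoose_eq]
      congr 1
      omega
    have h₃ : (m + 1).multichoose k = (m + k).choose k := by
      rw [Nat.multichoose_eq]
      congr 1
      omega
    rw [h₂, h₃]
    have h₄ : (((m + k + 1) * (m + k).choose k : ℕ) : ℚ) =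
        ((m + k + 1).choose (k + 1) * (k + 1) : ℕ) := by rw [h₁]
    push_cast at h₄
    linear_combination -h₄
  have hdim : ∀ k : ℕ, (Module.finrank ℂ (invariantComponent (m + 1) (k + 1)) : ℚ) =
      (m + 1).multichoose (k + 1) * (m + 1).multichoose (k + 1) -
        (m + 1).multichoose (k + 2) * (m + 1).multichoose k := by
    intro k
    rw [eq_sub_iff_add_eq]
    exact_mod_cast finrank_invariantComponent_succ_add k m
  cases d with
  | zero =>
    rw [hdim, finrank_invariantComponent_zero]
    have h₀ := hrec 0
    have h₁ := hrec 1
    simp only [Nat.multichoose_zero_right, Nat.cast_zero, Nat.cast_one] at h₀ h₁ ⊢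
    simp only [zero_add] at h₀ h₁ ⊢
    norm_num at h₀ h₁ ⊢
    linear_combination -h₁
  | succ d =>
    rw [hdim, hdim]
    have h₀ := hrec d
    have h₁ := hrec (d + 1)
    have h₂ := hrec (d + 2)
    push_cast at *
    -- `h₂` eliminates `h_{d+3}` and `h₀` eliminates `h_d`; multiples of `h₁` settle what remains in
    -- `h_{d+1}` and `h_{d+2}`.
    linear_combination -(d + 2 : ℚ) * (m + 1).multichoose (d + 1) * h₂ +
      ((d + 3 : ℚ) * (m + 1).multichoose (d + 2) -
        (m + d + 3) * (m + 1).multichoose (d + 1)) * h₁ -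
      (m + d + 2 : ℚ) * (m + 1).multichoose (d + 2) * h₀ +
      2 * (m + d + 2 : ℚ) * (m + 1).multichoose (d + 1) * h₁

end Narayana

/-! ### Hypergeometric series and Euler's transformation -/

namespace PowerSeries

theorem coeff_X_mul_derivative (G : PowerSeries ℚ) (k : ℕ) :
    coeff k (X * d⁄dX ℚ G) = k * coeff k G := by
  cases k with
  | zero => simp
  | succ k => rw [coeff_succ_X_mul, coeff_derivative]; push_cast; ring

/-- The hypergeometric differential equation, in terms of coefficients. -/
theorem hypergeometric_iff (α β γ : ℚ) (G : PowerSeries ℚ) :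
    X * (1 - X) * d⁄dX ℚ (d⁄dX ℚ G) + (C γ - C (α + β + 1) * X) * d⁄dX ℚ G - C (α * β) * G = 0 ↔
      ∀ k : ℕ, ((k : ℚ) + 1) * (k + γ) * coeff (k + 1) G = (k + α) * (k + β) * coeff k G := by
  have hcoeff : ∀ k : ℕ, coeff k (X * (1 - X) * d⁄dX ℚ (d⁄dX ℚ G) +
      (C γ - C (α + β + 1) * X) * d⁄dX ℚ G - C (α * β) * G) =
      ((k : ℚ) + 1) * (k + γ) * coeff (k + 1) G - (k + α) * (k + β) * coeff k G := by
    intro k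
    have h : X * (1 - X) * d⁄dX ℚ (d⁄dX ℚ G) + (C γ - C (α + β + 1) * X) * d⁄dX ℚ G -
        C (α * β) * G = X * d⁄dX ℚ (d⁄dX ℚ G) - X * (X * d⁄dX ℚ (d⁄dX ℚ G)) + C γ * d⁄dX ℚ G
          - C (α + β + 1) * (X * d⁄dX ℚ G) - C (α * β) * G := by ring
    rw [h]
    simp only [map_sub, map_add (coeff k), coeff_C_mul, coeff_X_mul_derivative, coeff_derivative]
    cases k with
    | zero => simp
    | succ k =>
      rw [coeff_succ_X_mul, coeff_X_mul_derivative, coeff_derivative]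
      push_cast
      ring
  rw [PowerSeries.ext_iff]
  refine forall_congr' fun k => ?_
  rw [hcoeff, map_zero, sub_eq_zero]

theorem hypergeometric_unique {α β γ : ℚ} (hγ : 0 < γ) {F G : PowerSeries ℚ}
    (h0 : coeff 0 F = coeff 0 G)
    (hF : ∀ k : ℕ, ((k : ℚ) + 1) * (k + γ) * coeff (k + 1) F = (k + α) * (k + β) * coeff k F)
    (hG : ∀ k : ℕ, ((k : ℚ) + 1) * (k + γ) * coeff (k + 1) G = (k + α) * (k + β) * coeff k G) :
    F = G := by
  ext k
  induction k with
  | zero => exact h0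
  | succ k ih =>
    have hpos : ((k : ℚ) + 1) * (k + γ) ≠ 0 := by positivity
    apply mul_left_cancel₀ hpos
    rw [hF, hG, ih]

/-- Euler's transformation of a hypergeometric series, at the level of differential equations. -/
theorem hypergeometric_euler {α β γ : ℚ} {s : ℕ} (hs : (s : ℚ) + 2 = α + β - γ) {F : PowerSeries ℚ}
    (hF : X * (1 - X) * d⁄dX ℚ (d⁄dX ℚ F) + (C γ - C (α + β + 1) * X) * d⁄dX ℚ F -
      C (α * β) * F = 0) :
    X * (1 - X) * d⁄dX ℚ (d⁄dX ℚ ((1 - X) ^ (s + 2) * F)) +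
      (C γ - C ((γ - α) + (γ - β) + 1) * X) * d⁄dX ℚ ((1 - X) ^ (s + 2) * F) -
        C ((γ - α) * (γ - β)) * ((1 - X) ^ (s + 2) * F) = 0 := by
  have h1 : d⁄dX ℚ (1 - X : PowerSeries ℚ) = -1 := by
    simp [derivative_X]
  -- Two derivatives are taken, so writing the exponent as `s + 2` keeps all powers of `1 - X`
  -- natural.
  have hD : ∀ (t : ℕ) (H : PowerSeries ℚ), d⁄dX ℚ ((1 - X) ^ (t + 1) * H) =
      (1 - X) ^ (t + 1) * d⁄dX ℚ H - C ((t : ℚ) + 1) * (1 - X) ^ t * H := by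
    intro t H
    rw [Derivation.leibniz, Derivation.leibniz_pow, h1]
    simp
    ring
  have hc := congrArg (C : ℚ → PowerSeries ℚ) hs
  rw [hD (s + 1), map_sub (d⁄dX ℚ), hD (s + 1), mul_assoc (C _) _ F, Derivation.leibniz, derivative_C,
    hD s]
  simp only [map_add, map_sub, map_mul, map_natCast, map_ofNat, map_one,
    smul_eq_mul, Nat.cast_add, Nat.cast_one] at hc hF ⊢
  -- Once `α` is eliminated, the new equation is exactly `(1 - X)^(s + 2)` times the old one.
  have hα : (C α : PowerSeries ℚ) = s + 2 - C β + C γ := by linear_combination -hc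
  rw [hα] at hF ⊢
  linear_combination (1 - X) ^ (s + 2) * hF

end PowerSeries

/-! ### Closed form of the Hilbert series -/

theorem coeff_invariantHilbertSeries (n d : ℕ) :
    PowerSeries.coeff d (invariantHilbertSeries n) = Module.finrank ℂ (invariantComponent n d) :=
  PowerSeries.coeff_mk _ _

theorem cast_choose_succ_mul (n k : ℕ) :
    ((k : ℚ) + 1) * n.choose (k + 1) = (n - k) * n.choose k := by
  rcases le_or_gt k n with h | h
  · have := Nat.choose_succ_right_eq n k
    rw [← Nat.cast_sub h]
    norm_cast
    linarith
  · rw [Nat.choose_eq_zero_of_lt h, Nat.choose_eq_zero_of_lt (by omega)]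
    simp

theorem coeff_sum_narayana (m k : ℕ) (hm : 2 ≤ m) :
    PowerSeries.coeff k (∑ k ∈ Finset.range (m - 1),
      PowerSeries.C ((1 / ((k : ℚ) + 1)) * ((m - 2).choose k : ℚ) * ((m - 1).choose k : ℚ)) *
        PowerSeries.X ^ k) =
      (1 / ((k : ℚ) + 1)) * ((m - 2).choose k : ℚ) * ((m - 1).choose k : ℚ) := by
  simp only [map_sum, PowerSeries.coeff_C_mul, PowerSeries.coeff_X_pow, mul_ite, mul_one, mul_zero,
    Finset.sum_ite_eq, Finset.mem_range]
  split_ifs with h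
  · rfl
  · rw [Nat.choose_eq_zero_of_lt (show m - 2 < k by omega)]
    simp

theorem one_sub_X_pow_mul_invariantHilbertSeries (m : ℕ) (hm : 2 ≤ m) :
    (1 - PowerSeries.X) ^ (2 * m - 1) * invariantHilbertSeries (m + 1) =
      ∑ k ∈ Finset.range (m - 1),
        PowerSeries.C ((1 / ((k : ℚ) + 1)) * ((m - 2).choose k : ℚ) * ((m - 1).choose k : ℚ)) *
          PowerSeries.X ^ k := by
  obtain ⟨m, rfl⟩ := Nat.exists_eq_add_of_le' hm
  have hF := (PowerSeries.hypergeometric_iff ((m + 2 : ℕ) + 1 : ℚ) (m + 2 : ℕ) 2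
    (invariantHilbertSeries (m + 2 + 1))).2 fun k => by
      rw [coeff_invariantHilbertSeries, coeff_invariantHilbertSeries,
        finrank_invariantComponent_recursion]
      ring
  -- After the shift of `m` by `2`, the parameters are `α = m + 3`, `β = m + 2`, `γ = 2`, so `α + β
  -- - γ = 2m + 3 = s + 2`, the exponent in the goal.
  have hG := (PowerSeries.hypergeometric_iff _ _ _ _).1
    (PowerSeries.hypergeometric_euler (s := 2 * m + 1) (by push_cast; ring) hF)
  refine PowerSeries.hypergeometric_unique two_pos ?_ hG ?_
  · rw [coeff_sum_narayana _ _ hm, PowerSeries.coeff_zero_eq_constantCoeff_apply, map_mul,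
      ← PowerSeries.coeff_zero_eq_constantCoeff_apply (invariantHilbertSeries _), coeff_invariantHilbertSeries, finrank_invariantComponent_zero]
    simp
  · intro k
    rw [coeff_sum_narayana _ _ hm, coeff_sum_narayana _ _ hm]
    have h₁ := cast_choose_succ_mul (m + 2 - 2) k
    have h₂ := cast_choose_succ_mul (m + 2 - 1) k
    simp only [show m + 2 - 2 = m by omega, show m + 2 - 1 = m + 1 by omega] at h₁ h₂ ⊢
    have h₃ : ((k : ℚ) + 1) ≠ 0 := by positivity
    have h₄ : ((k : ℚ) + 1 + 1) ≠ 0 := by positivity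
    push_cast at h₁ h₂ ⊢
    field_simp
    linear_combination ((k : ℚ) + 2) * (((k : ℚ) + 1) * (m + 1).choose (k + 1) * h₁ +
      (m - k : ℚ) * m.choose k * h₂)

/-- Here `m = n - 1`, so `2m - 1 = 2n - 3`. Clearing the denominator loses nothing, as `1 - X` is a
unit among power series. -/
theorem mainTheorem4 (m : ℕ) :
    (∀ d : ℕ,
      LinearIndependent ℂ
        (fun π : ParallelogramPolyomino (d + 1) m => π.minorMonomial) ∧
      Submodule.span ℂ
        (Set.range fun π : ParallelogramPolyomino (d + 1) m => π.minorMonomial) =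
          invariantComponent (m + 1) d) ∧
    (iSupIndep (invariantComponent (m + 1)) ∧
      ⨆ d : ℕ, invariantComponent (m + 1) d = Subalgebra.toSubmodule (invariantRing (m + 1))) ∧
    invariantHilbertSeries (m + 1) =
      PowerSeries.mk (fun d => (Nat.card (ParallelogramPolyomino (d + 1) m) : ℚ)) ∧
    (2 ≤ m →
      (1 - PowerSeries.X) ^ (2 * m - 1) * invariantHilbertSeries (m + 1) =
        ∑ k ∈ Finset.range (m - 1),
          PowerSeries.C ((1 / ((k : ℚ) + 1)) * ((m - 2).choose k : ℚ) * ((m - 1).choose k : ℚ)) *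
            PowerSeries.X ^ k) := by
  refine ⟨fun d => ⟨linearIndependent_minorMonomial d m, span_minorMonomial d m⟩,
    ⟨iSupIndep_invariantComponent _, iSup_invariantComponent _⟩, ?_,
    one_sub_X_pow_mul_invariantHilbertSeries m⟩
  ext d
  rw [coeff_invariantHilbertSeries, PowerSeries.coeff_mk, Nat.card_eq_fintype_card,
    card_eq_finrank_invariantComponent]
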